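/- **Setting.** Let $\mathcal G=(\mathcal V,\mathcal E)$ be a finite connected undirected graph, $k\in\mathbb N$, $\mathcal N_i$ the neighbours of $i$, and let $\mathcal N_i^{k}$ be the set of agents at graph distance $2,\dots,k$ from $i$, $\eta_i=|\mathcal N_i^{k}|$. Agent $i\in\mathcal V$ has state $x_i\in\mathbb R^N$ and dynamics $\dot x_i=f(x_i)+Ax_i+u_i$, where $A\in\mathbb R^{N\times N}$ and $f$ is globally Lipschitz with constant $l_f$. Agent $i$ holds estimates $\hat x^i_l,\hat u^i_l$ of $x_l,u_l$ for $l\in\mathcal N_i^{k}$, with errors $\tilde x^i_l=x_l-\hat x^i_l$, $\tilde u^i_l=u_l-\hat u^i_l$; $\tilde{\mathbf x}$ and $\tilde{\mathbf u}$ stack all of them. For a family $w$ of true values and $\hat w$ of estimates put $$\xi^i_l(w,\hat w)=\sum_{j\in\mathcal N_i,\ l\in\mathcal N_j^{k}}(\hat w^j_l-\hat w^i_l)+\sum_{j\in\mathcal N_i\cap\mathcal N_l}(w_l-\hat w^i_l).$$ The agents run, for $i\in\mathcal V$ and $l\in\mathcal N_i^k$, the observers $$\dot{\hat x}^i_l=f(\hat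 x^i_l)+A\hat x^i_l+\omega_lG\,\xi^i_l(x,\hat x)+\theta_l\,\mathrm{sign}\big(G\,\xi^i_l(x,\hat x)\big)+\hat u^i_l,\qquad \dot{\hat u}^i_l=\pi_l\,\mathrm{sign}\big(\xi^i_l(u,\hat u)\big)$$ (sign entrywise, $\mathrm{sign}(r)=1$ for $r\ge0$ and $-1$ for $r<0$) and the feedback $u_i=q_i(\bar x_i,\hat x^i)$, where $q_i$ is continuous, $\bar x_i=(x_j)_{j\in\{i\}\cup\mathcal N_i}$ and $\hat x^i=(\hat x^i_l)_{l\in\mathcal N_i^k}$. Solutions of the closed loop in $(\mathbf x,\hat{\mathbf x},\hat{\mathbf u})$ are Filippov solutions on $[0,\infty)$: locally absolutely continuous, with derivative almost everywhere in $K[F]$, $K[F](y)=\bigcap_{\delta>0}\bigcap_{\mu(M)=0}\overline{\mathrm{co}}\,F(B(y,\delta)\setminus M)$, $F$ being the right-hand side. Write $\Phi(\mathbf x,\tilde{\mathbf x})=\mathbf f(\mathbf x)+(I\otimes A)\mathbf x+\mathbf q(\mathbf x,\mathbf x-\tilde{\mathbf x})$ for the right-hand side of the equation of $\mathbf x$,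 that is, $\Phi_i=f(x_i)+Ax_i+q_i\big(\bar x_i,(x_l-\tilde x^i_l)_{l\in\mathcal N_i^k}\big)$. **Gains.** For $i$ with $\mathcal N_i^k\ne\emptyset$ let $M_i$ be the Laplacian of the subgraph induced by $\mathcal N_i^k$ plus $\mathrm{diag}(|\mathcal N_l\cap\mathcal N_i|)_{l\in\mathcal N_i^k}$. Assume that $G$ is symmetric positive definite with $G^\top A+A^\top G-2G^\top G\prec0$ and that for each such $i$ $$\omega_i\ge\tfrac1{\lambda_{\min}(M_i)}\Big(1+\tfrac{l_f\|M_i\otimes G\|}{\lambda_{\min}(M_i)\lambda_{\min}(G^\top G)}\Big),\qquad\theta_i>0,\qquad \pi_i>\tfrac{\lambda_{\max}(M_i)}{\lambda_{\min}(M_i)}\sqrt{\eta_i}\,d_i .$$ **Set-ISS.** $\Phi$ is set-ISS with respect to $\mathcal A$ if there are $\beta\in\mathcal{KL}$, $\gamma\in\mathcal K$ such that for every bounded measurable $e$ on $[0,\infty)$ and every solution on $[0,\infty)$ of $\dot{\mathbf x}=\Phi(\mathbf x,e(t))$ one has, for all $t\ge0$, $\mathrm{dist}(\mathbf x(t),\mathcal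 A)\le\beta(\mathrm{dist}(\mathbf x(0),\mathcal A),t)+\gamma(\sup_{0\le\tau\le t}\|e(\tau)\|)$. Here $\gamma\in\mathcal K$ means continuous and strictly increasing on $[0,\infty)$ with $\gamma(0)=0$, and $\beta\in\mathcal{KL}$ means that $\beta(\cdot,t)\in\mathcal K$ for each $t\ge0$ and $\beta(r,\cdot)$ is nonincreasing with limit $0$ for each $r\ge0$. **Theorem (closed-loop stability).** Let $\mathcal A$ be a nonempty set with respect to which $\Phi$ is set-ISS. Consider a closed-loop solution on $[0,\infty)$ along which each $u_i(t)=q_i(\bar x_i(t),\hat x^i(t))$ is locally absolutely continuous with $\|z\|\le d_i$ for all $t>0$ and $z\in K[\dot q_i](t)$, where $\dot q_i$ is the time derivative of $u_i$ along the solution. Then: 1. there is $T_{xu}>0$ with $\tilde{\mathbf x}(t)=0$ and $\tilde{\mathbf u}(t)=0$ for all $t>T_{xu}$; 2. $\mathrm{dist}(\mathbf x(t),\mathcal A)\to0$ as $t\to\infty$; 3. if moreover the nominal controller reaches the objective, i.e. every solution on $[0,\infty)$ of $\dot{\mathbf y}=\Phi(\mathbf y,0)$ converges to some $\mathbf y^*\in\mathcal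 A$ with $\Phi(\mathbf y^*,0)=0$, then $\mathbf x(t)$ converges to some $\mathbf x^*\in\mathcal A$ with $\Phi(\mathbf x^*,0)=0$. -/

import Mathlib

open Set Filter Topology MeasureTheory
open scoped NNReal Matrix Kronecker

noncomputable section

/-! ### Nonsmooth dynamics -/

/-- The function `sign` of the observers: `1` on `[0, ∞)` and `-1` on `(-∞, 0)`. -/
def sgn (r : ℝ) : ℝ := if 0 ≤ r then 1 else -1

/-- The Filippov set-valued map
`K[f](y) = ⋂_{δ > 0} ⋂_{μ(M) = 0} closure (conv (f (B(y, δ) \ M)))`. -/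
def filippov {X Y : Type*} [PseudoMetricSpace X] [MeasureSpace X]
    [NormedAddCommGroup Y] [NormedSpace ℝ Y] (f : X → Y) (y : X) : Set Y :=
  ⋂ (δ : ℝ) (_ : 0 < δ) (M : Set X) (_ : volume M = 0),
    closure (convexHull ℝ (f '' (Metric.ball y δ \ M)))

/-- Local absolute continuity on `[0, ∞)`. -/
def LocallyAC {X : Type*} [PseudoMetricSpace X] (y : ℝ → X) : Prop :=
  ∀ T : ℝ, 0 < T → AbsolutelyContinuousOnInterval y 0 T

/-- `y` is a solution on `[0, ∞)` of the differential inclusion `y'(t) ∈ F t (y t)`: it is locally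
absolutely continuous and satisfies the inclusion at almost every time. -/
def IsInclusionSolution {X : Type*} [NormedAddCommGroup X] [NormedSpace ℝ X]
    (F : ℝ → X → Set X) (y : ℝ → X) : Prop :=
  LocallyAC y ∧ ∀ᵐ t : ℝ, 0 < t → ∃ v ∈ F t (y t), HasDerivAt y v t

/-- Filippov solutions on `[0, ∞)` of `y' = F(y)` with `F` possibly discontinuous. -/
def IsFilippovSolution {X : Type*} [NormedAddCommGroup X] [NormedSpace ℝ X] [MeasureSpace X]
    (F : X → X) (y : ℝ → X) : Prop :=
  IsInclusionSolution (fun _ => filippov F) y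

/-- Caratheodory solutions on `[0, ∞)` of `y' = Φ(y, e(t))` for an input signal `e`. -/
def IsForcedSolution {X W : Type*} [NormedAddCommGroup X] [NormedSpace ℝ X]
    (Φ : X → W → X) (e : ℝ → W) (y : ℝ → X) : Prop :=
  IsInclusionSolution (fun t x => {Φ x (e t)}) y

/-! ### Comparison functions and set-input-to-state stability -/

/-- Class `𝒦`: continuous, strictly increasing on `[0, ∞)`, zero at zero. -/
def ClassK (γ : ℝ → ℝ) : Prop :=
  ContinuousOn γ (Ici 0) ∧ StrictMonoOn γ (Ici 0) ∧ γ 0 = 0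

/-- Class `𝒦ℒ`: `β(·, t)` is of class `𝒦` for each `t ≥ 0`, and `β(r, ·)` is nonincreasing with
limit `0` for each `r ≥ 0`. -/
def ClassKL (β : ℝ → ℝ → ℝ) : Prop :=
  (∀ t, 0 ≤ t → ClassK (fun r => β r t)) ∧
    ∀ r, 0 ≤ r → AntitoneOn (β r) (Ici 0) ∧ Tendsto (β r) atTop (𝓝 0)

/-- The system `y' = Φ(y, e)` is set-ISS with respect to `𝒜`. -/
def SetISS {X W : Type*} [NormedAddCommGroup X] [NormedSpace ℝ X] [NormedAddCommGroup W]
    (Φ : X → W → X) (𝒜 : Set X) : Prop :=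
  ∃ β γ, ClassKL β ∧ ClassK γ ∧
    ∀ (e : ℝ → W) (y : ℝ → X),
      AEStronglyMeasurable e (volume.restrict (Ici 0)) →
      BddAbove ((fun τ => ‖e τ‖) '' Ici 0) →
      IsForcedSolution Φ e y →
      ∀ t, 0 ≤ t → Metric.infDist (y t) 𝒜 ≤
        β (Metric.infDist (y 0) 𝒜) t + γ (sSup ((fun τ => ‖e τ‖) '' Icc 0 t))

/-! ### Communication graph -/

section Graph

variable {V : Type*} [Fintype V] [DecidableEq V]

open Classical in
/-- The (1-hop) neighbours of agent `i`. -/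
def nbr (G : SimpleGraph V) (i : V) : Finset V := Finset.univ.filter (fun j => G.Adj i j)

open Classical in
/-- The `k`-hop neighbours of agent `i`: the agents at graph distance `2, …, k` from `i`. -/
def khop (G : SimpleGraph V) (k : ℕ) (i : V) : Finset V :=
  Finset.univ.filter (fun l => 2 ≤ G.dist i l ∧ G.dist i l ≤ k)

/-- The ordered pairs `⟨i, l⟩` with `l` a `k`-hop neighbour of `i`: these index the estimates
"made by `i`, of agent `l`". -/
abbrev EstIndex (G : SimpleGraph V) (k : ℕ) : Type _ := Σ i : V, khop G k i

open Classical in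
/-- `M_i`: the Laplacian of the subgraph induced by the `k`-hop neighbours of `i`, plus the diagonal
matrix of the numbers of common neighbours `|𝒩_l ∩ 𝒩_i|`. -/
def khopMatrix (G : SimpleGraph V) (k : ℕ) (i : V) : Matrix (khop G k i) (khop G k i) ℝ :=
  (SimpleGraph.comap (Subtype.val : khop G k i → V) G).lapMatrix ℝ +
    Matrix.diagonal (fun l : khop G k i => ((nbr G l ∩ nbr G i).card : ℝ))

end Graph

/-- Least eigenvalue of a real symmetric matrix. -/
def lamMin {ι : Type*} [Fintype ι] [DecidableEq ι] (M : Matrix ι ι ℝ) : ℝ := sInf (spectrum ℝ M)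

/-- Greatest eigenvalue of a real symmetric matrix. -/
def lamMax {ι : Type*} [Fintype ι] [DecidableEq ι] (M : Matrix ι ι ℝ) : ℝ := sSup (spectrum ℝ M)

/-- Spectral (Euclidean operator) norm of a real square matrix. -/
def specNorm {ι : Type*} [Fintype ι] [DecidableEq ι] (M : Matrix ι ι ℝ) : ℝ :=
  ‖Matrix.toEuclideanCLM (𝕜 := ℝ) M‖

/-! ### The multi-agent system and its observers -/

/-- The space `ℝ^N` of the state (and of the input) of one agent. -/
abbrev AgentVec (N : ℕ) : Type := EuclideanSpace ℝ (Fin N)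

/-- Stacked vectors `(x_i)_{i ∈ V}`, with the Euclidean norm of `ℝ^{nN}`. -/
abbrev TeamVec (V : Type*) [Fintype V] (N : ℕ) : Type _ := PiLp 2 (fun _ : V => AgentVec N)

/-- Stacked vectors of estimates (or estimation errors), with the Euclidean norm. -/
abbrev EstVec {V : Type*} [Fintype V] [DecidableEq V] (G : SimpleGraph V) (k : ℕ) (N : ℕ) :
    Type _ :=
  PiLp 2 (fun _ : EstIndex G k => AgentVec N)

/-- Lebesgue measure on the stacked vectors. -/
instance {V : Type*} [Fintype V] {N : ℕ} : MeasureSpace (TeamVec V N) :=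
  measureSpaceOfInnerProductSpace

/-- Lebesgue measure on the stacked estimates. -/
instance {V : Type*} [Fintype V] [DecidableEq V] {G : SimpleGraph V} {k N : ℕ} :
    MeasureSpace (EstVec G k N) :=
  measureSpaceOfInnerProductSpace

/-- The data of the agents: the communication graph, the number `k` of hops, the dynamics
`x_i' = f(x_i) + A x_i + u_i`, and for each agent a feedback law `q_i(x̄_i, x^i)` of the states `x̄_i`
of `i` and its neighbours and of the states `x^i` of its `k`-hop neighbours. -/
structure MultiAgentSystem (V : Type*) [Fintype V] [DecidableEq V] (N : ℕ) where
  graph : SimpleGraph V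
  k : ℕ
  f : AgentVec N → AgentVec N
  A : Matrix (Fin N) (Fin N) ℝ
  q : ∀ i : V, ((insert i (nbr graph i) : Finset V) → AgentVec N) →
    (khop graph k i → AgentVec N) → AgentVec N

/-- The design parameters of the observers. -/
structure ObserverGains (V : Type*) (N : ℕ) where
  G : Matrix (Fin N) (Fin N) ℝ
  ω : V → ℝ
  θ : V → ℝ
  π : V → ℝ

namespace MultiAgentSystem

variable {V : Type*} [Fintype V] [DecidableEq V] {N : ℕ} (S : MultiAgentSystem V N)

/-- Vectors of the estimates held by all agents. -/
abbrev Est : Type _ := EstVec S.graph S.k N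

/-- State `(x, x̂, û)` of the closed loop. -/
abbrev LoopState : Type _ := TeamVec V N × S.Est × S.Est

/-- The true values of the estimated quantities: the entry `⟨i, l⟩` is `w_l`. -/
def truth (w : TeamVec V N) : S.Est := WithLp.toLp 2 (fun p => w p.2)

/-- The feedback `u_i = q_i(x̄_i, x̂^i)`. -/
def feedback (x : TeamVec V N) (xh : S.Est) : TeamVec V N :=
  WithLp.toLp 2 (fun i => S.q i (fun j => x j) (fun l => xh ⟨i, l⟩))

/-- `f(x) + (I_n ⊗ A) x + u`. -/
def plant (x u : TeamVec V N) : TeamVec V N :=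
  WithLp.toLp 2 (fun i => S.f (x i) + Matrix.toEuclideanCLM (𝕜 := ℝ) S.A (x i) + u i)

/-- `Φ(x, x̃) = f(x) + (I_n ⊗ A) x + q(x, x - x̃)`. -/
def Φ (x : TeamVec V N) (xt : S.Est) : TeamVec V N :=
  S.plant x (S.feedback x (S.truth x - xt))

/-- Communicated innovation: the entry `⟨i, l⟩` is the sum, over the neighbours `j` of `i`, of
`ŵ^j_l - ŵ^i_l` if `l` is a `k`-hop neighbour of `j`, and of `w_l - ŵ^i_l` if `l` is a neighbour
of `j`. -/
def innovation (w : TeamVec V N) (wh : S.Est) : S.Est :=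
  WithLp.toLp 2 (fun p => ∑ j ∈ nbr S.graph p.1,
    ((if h : (p.2 : V) ∈ khop S.graph S.k j then wh ⟨j, ⟨p.2, h⟩⟩ - wh p else 0) +
      (if (p.2 : V) ∈ nbr S.graph j then w p.2 - wh p else 0)))

/-- Right-hand side of the state observer: the entry `⟨i, l⟩` is
`f(x̂^i_l) + A x̂^i_l + ω_l G ξ^i_l + θ_l sign(G ξ^i_l) + û^i_l`, with `sign` taken entrywise. -/
def stateObserver (g : ObserverGains V N) (x : TeamVec V N) (xh uh : S.Est) : S.Est :=
  WithLp.toLp 2 (fun p =>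
    let Gξ : AgentVec N := Matrix.toEuclideanCLM (𝕜 := ℝ) g.G (S.innovation x xh p)
    S.f (xh p) + Matrix.toEuclideanCLM (𝕜 := ℝ) S.A (xh p) + g.ω p.2 • Gξ +
      g.θ p.2 • WithLp.toLp 2 (fun a => sgn (Gξ a)) + uh p)

/-- Right-hand side of the input observer: the entry `⟨i, l⟩` is `π_l sign(ρ^i_l)`. -/
def inputObserver (g : ObserverGains V N) (u : TeamVec V N) (uh : S.Est) : S.Est :=
  WithLp.toLp 2 (fun p => g.π p.2 • WithLp.toLp 2 (fun a => sgn (S.innovation u uh p a)))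

/-- The vector field of the closed loop: agents with feedback from estimates, state observers and
input observers. -/
def closedLoop (g : ObserverGains V N) (z : S.LoopState) : S.LoopState :=
  (S.plant z.1 (S.feedback z.1 z.2.1),
    S.stateObserver g z.1 z.2.1 z.2.2,
    S.inputObserver g (S.feedback z.1 z.2.1) z.2.2)

/-- Under perfect state knowledge, `u = q(x)` drives the team to an equilibrium in `𝒜`. -/
def NominalReaches (𝒜 : Set (TeamVec V N)) : Prop :=
  ∀ y : ℝ → TeamVec V N, IsForcedSolution S.Φ (fun _ => 0) y →
    ∃ xs ∈ 𝒜, S.Φ xs 0 = 0 ∧ Tendsto y atTop (𝓝 xs)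

end MultiAgentSystem

end

/-! The errors decouple when grouped by the estimated agent `l` instead of the estimating agent:
being a `k`-hop neighbour is symmetric, so the agents `i` that estimate `l` are exactly its `k`-hop
neighbours. In the column of `l` the innovation is `(M_l ⊗ 1) e` (`column_innovation`), and `M_l` is
positive definite because shortest paths lead to vertices that share a neighbour with `l`
(`posDef_khopMatrix`).

A column error `e` is controlled by `W = ⟪e, P e⟫`. If `⟪P e, e'⟫ ≤ -c ‖P e‖`, then `W' ≤ -2c √λ √W`
with `λ = lamMin P`, and `e` vanishes in finite time. The observers are built so that the argument
of the sign is `P e`, and any selection `s` of the set-valued sign satisfies `⟪P e, s⟫ ≥ ‖P e‖`. For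
the inputs, `P = M_l ⊗ 1`, and the sign term beats the drift `u_l'`, of norm at most `√η_l d_l` in
the column. Once the input error is zero, `P = M_l ⊗ G` serves for the states: the gain `ω_l`
absorbs the linear and Lipschitz terms (`inner_add_inner_le_gain`), leaving `-θ_l ‖P e‖`.

The closed-loop solution is given on all of `[0, ∞)`, so nothing has to be controlled before the
errors vanish. Afterwards the team solves `x' = Φ(x, 0)`; set-ISS with zero input and the nominal
convergence then give the last two claims. -/

/-! ### Absolutely continuous functions -/

/-- Composing an absolutely continuous function with a Lipschitz one. -/
theorem AbsolutelyContinuousOnInterval.comp_lipschitzOn {X Y : Type*} [PseudoMetricSpace X]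
    [PseudoMetricSpace Y] {y : ℝ → X} {φ : X → Y} {s : Set X} {K : ℝ≥0} {a b : ℝ}
    (hy : AbsolutelyContinuousOnInterval y a b) (hφ : LipschitzOnWith K φ s)
    (hs : MapsTo y (uIcc a b) s) :
    AbsolutelyContinuousOnInterval (fun t => φ (y t)) a b := by
  have h0 := Tendsto.const_mul (K : ℝ) hy
  rw [mul_zero] at h0
  refine squeeze_zero' (Eventually.of_forall fun _ => Finset.sum_nonneg fun _ _ => dist_nonneg)
    ?_ h0
  rw [eventually_inf_principal]
  filter_upwards with E hE
  rw [Finset.mul_sum]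
  refine Finset.sum_le_sum fun i hi => ?_
  exact hφ.dist_le_mul _ (hs (hE.1 i hi).1) _ (hs (hE.1 i hi).2)

/-- Composing an absolutely continuous function with a continuously differentiable one. -/
theorem AbsolutelyContinuousOnInterval.comp_contDiff {E Y : Type*} [NormedAddCommGroup E]
    [NormedSpace ℝ E] [FiniteDimensional ℝ E] [NormedAddCommGroup Y] [NormedSpace ℝ Y]
    {y : ℝ → E} {φ : E → Y} {a b : ℝ}
    (hy : AbsolutelyContinuousOnInterval y a b) (hφ : ContDiff ℝ 1 φ) :
    AbsolutelyContinuousOnInterval (fun t => φ (y t)) a b := by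
  have : ProperSpace E := FiniteDimensional.proper_real E
  obtain ⟨C, hC⟩ := hy.exists_bound
  obtain ⟨K, hK⟩ := (hφ.contDiffOn (s := Metric.closedBall 0 C)).exists_lipschitzOnWith
    (by decide) (convex_closedBall _ _) (isCompact_closedBall _ _)
  exact hy.comp_lipschitzOn hK fun t ht => by simpa using hC t ht

/-- An absolutely continuous function whose derivative is almost everywhere at most `m` grows at
most at rate `m`. -/
theorem AbsolutelyContinuousOnInterval.sub_le_of_ae_deriv_le {h : ℝ → ℝ} {a b m : ℝ} (hab : a ≤ b)
    (hh : AbsolutelyContinuousOnInterval h a b)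
    (hd : ∀ᵐ t : ℝ, a < t → t < b → ∃ w ≤ m, HasDerivAt h w t) :
    h b - h a ≤ m * (b - a) := by
  rw [← hh.integral_deriv_eq_sub]
  have h1 : ∫ _ in a..b, m = m * (b - a) := by simp [mul_comm]
  rw [← h1]
  refine intervalIntegral.integral_mono_ae_restrict hab hh.intervalIntegrable_deriv (by simp) ?_
  have hb : ∀ᵐ t : ℝ, t ≠ b := by simp [ae_iff]
  have ha : ∀ᵐ t : ℝ, t ≠ a := by simp [ae_iff]
  refine (ae_restrict_iff' measurableSet_Icc).2 ?_
  filter_upwards [hd, ha, hb] with t ht hta htb hmem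
  obtain ⟨w, hw, hw'⟩ := ht (lt_of_le_of_ne hmem.1 hta.symm) (lt_of_le_of_ne hmem.2 htb)
  rw [hw'.deriv]
  exact hw

/-- Finite-time convergence: a nonnegative absolutely continuous function with `W' ≤ -c √W`
vanishes after some time. -/
theorem eventually_eq_zero_of_deriv_le_neg_sqrt {W : ℝ → ℝ} {a c : ℝ} (hc : 0 < c)
    (hW : ∀ t, 0 ≤ W t) (hAC : ∀ b, a < b → AbsolutelyContinuousOnInterval W a b)
    (hd : ∀ᵐ t : ℝ, a < t → ∃ w, HasDerivAt W w t ∧ w ≤ -c * √(W t)) :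
    ∀ᶠ t in atTop, W t = 0 := by
  have hanti : ∀ s t, a ≤ s → s ≤ t → W t ≤ W s := by
    intro s t has hst
    rcases hst.eq_or_lt with rfl | hst'
    · exact le_rfl
    have := ((hAC t (has.trans_lt hst')).mono
      (by rw [uIcc_of_le hst, uIcc_of_le (has.trans hst)]; exact Icc_subset_Icc_left has :
        uIcc s t ⊆ uIcc a t)).sub_le_of_ae_deriv_le (m := 0) hst (by
      filter_upwards [hd] with r hr hsr _
      obtain ⟨w, hw, hw'⟩ := hr (has.trans_lt hsr)
      exact ⟨w, hw'.trans (by have := Real.sqrt_nonneg (W r); nlinarith), hw⟩)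
    linarith
  -- While `W > 0`, `√W` decreases at rate at least `c / 2`, hence cannot stay positive for longer
  -- than `2 √(W a) / c`.
  filter_upwards [eventually_gt_atTop (a + 2 * √(W a) / c)] with t ht
  by_contra hne
  have hpos : 0 < W t := lt_of_le_of_ne (hW t) (Ne.symm hne)
  have hat : a < t := by
    have : 0 ≤ 2 * √(W a) / c := by positivity
    linarith
  -- Monotonicity keeps `W` above `W t > 0` on `[a, t]`, away from the singularity of the square
  -- root, so `√W` is absolutely continuous there.
  have hsub : MapsTo W (uIcc a t) (Icc (W t) (W a)) := by
    rw [uIcc_of_le hat.le]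
    exact fun s hs => ⟨hanti s t hs.1 hs.2, hanti a s le_rfl hs.1⟩
  have hcd : ContDiffOn ℝ 1 Real.sqrt (Icc (W t) (W a)) := fun x hx =>
    (Real.contDiffAt_sqrt (hpos.trans_le hx.1).ne').contDiffWithinAt
  obtain ⟨K, hK⟩ := hcd.exists_lipschitzOnWith (by decide) (convex_Icc _ _) isCompact_Icc
  have := ((hAC t hat).comp_lipschitzOn hK hsub).sub_le_of_ae_deriv_le (m := -c / 2) hat.le (by
    filter_upwards [hd] with r hr har hrt
    obtain ⟨w, hw, hw'⟩ := hr har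
    have hWr : 0 < W r := hpos.trans_le (hanti r t har.le hrt.le)
    refine ⟨w / (2 * √(W r)), ?_, hw.sqrt hWr.ne'⟩
    have : 0 < √(W r) := Real.sqrt_pos.2 hWr
    rw [div_le_iff₀ (by positivity)]
    linarith)
  have h1 : 0 < √(W t) := Real.sqrt_pos.2 hpos
  have h2 : 2 * √(W a) / c < t - a := by linarith
  rw [div_lt_iff₀ hc] at h2
  linarith

/-- A locally absolutely continuous function is differentiable at almost every positive time. -/
theorem LocallyAC.ae_differentiableAt {E : Type*} [NormedAddCommGroup E] [NormedSpace ℝ E]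
    [FiniteDimensional ℝ E] {y : ℝ → E} (hy : LocallyAC y) :
    ∀ᵐ t : ℝ, 0 < t → DifferentiableAt ℝ y t := by
  have h : ∀ n : ℕ, ∀ᵐ t : ℝ, t ∈ uIcc 0 ((n : ℝ) + 1) → DifferentiableAt ℝ y t := fun n =>
    (hy (n + 1) (by positivity)).boundedVariationOn.ae_differentiableAt_of_mem_uIcc
  filter_upwards [ae_all_iff.2 h] with t ht h0
  obtain ⟨n, hn⟩ := exists_nat_ge t
  refine ht n ?_
  rw [uIcc_of_le (by positivity)]
  exact ⟨h0.le, by linarith⟩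

theorem LocallyAC.comp_clm {E Y : Type*} [NormedAddCommGroup E] [NormedSpace ℝ E]
    [NormedAddCommGroup Y] [NormedSpace ℝ Y] {y : ℝ → E} (hy : LocallyAC y) (L : E →L[ℝ] Y) :
    LocallyAC (fun t => L (y t)) := fun T hT =>
  (hy T hT).comp_lipschitzOn (L.lipschitz.lipschitzOnWith (s := univ)) (mapsTo_univ _ _)

theorem LocallyAC.shift {X : Type*} [PseudoMetricSpace X] {y : ℝ → X} (hy : LocallyAC y)
    {T₀ : ℝ} (hT₀ : 0 ≤ T₀) : LocallyAC (fun t => y (t + T₀)) := by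
  intro T hT
  have h := hy (T + T₀) (by linarith)
  rw [absolutelyContinuousOnInterval_iff] at h ⊢
  intro ε hε
  obtain ⟨δ, hδ, h⟩ := h ε hε
  refine ⟨δ, hδ, fun E hE hlen => ?_⟩
  refine h (E.1, fun i => ((E.2 i).1 + T₀, (E.2 i).2 + T₀)) ⟨fun i hi => ?_, ?_⟩ (by simpa using hlen)
  · have := hE.1 i hi
    rw [uIcc_of_le hT.le] at this
    rw [uIcc_of_le (by linarith)]
    simp only [mem_Icc] at this ⊢
    constructor <;> constructor <;> linarith [this.1.1, this.1.2, this.2.1, this.2.2]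
  · intro i hi j hj hij
    have := hE.2 hi hj hij
    simp only [Function.onFun, Set.disjoint_left] at this ⊢
    intro x hx hx'
    refine this (a := x - T₀) ?_ ?_
    · simp only [uIoc, mem_Ioc, min_add_add_right, max_add_add_right] at hx ⊢
      constructor <;> linarith [hx.1, hx.2]
    · simp only [uIoc, mem_Ioc, min_add_add_right, max_add_add_right] at hx' ⊢
      constructor <;> linarith [hx'.1, hx'.2]

/-! ### The Filippov map -/

/-- One small ball with `M = ∅` is enough: the preimage of `C` under `L` is closed and convex, so it
contains the closed convex hull of the values of `F` on that ball. -/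
theorem mem_of_mem_filippov {X Y Z : Type*} [PseudoMetricSpace X] [MeasureSpace X]
    [NormedAddCommGroup Y] [NormedSpace ℝ Y] [NormedAddCommGroup Z] [NormedSpace ℝ Z]
    {F : X → Y} {y : X} {v : Y} (hv : v ∈ filippov F y) (L : Y →L[ℝ] Z) {C : Set Z}
    (hC : IsClosed C) (hC' : Convex ℝ C) (hF : ∀ᶠ z in 𝓝 y, L (F z) ∈ C) : L v ∈ C := by
  obtain ⟨δ, hδ, hball⟩ := Metric.eventually_nhds_iff_ball.1 hF
  simp only [filippov, mem_iInter] at hv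
  have h := hv δ hδ ∅ measure_empty
  have hsub : closure (convexHull ℝ (F '' (Metric.ball y δ \ ∅))) ⊆ L ⁻¹' C := by
    refine closure_minimal (convexHull_min ?_ ?_) (hC.preimage L.continuous)
    · rintro _ ⟨z, hz, rfl⟩
      exact hball z hz.1
    · exact hC'.linear_preimage L.toLinearMap
  exact hsub h

/-- If a linear functional of `F` is a continuous function plus `θ` times the sign of a continuous
function, then its values on the Filippov set of `F` are obtained by replacing the sign by a
selection of the set-valued sign. -/
theorem exists_sign_of_mem_filippov {X Y : Type*} [PseudoMetricSpace X] [MeasureSpace X]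
    [NormedAddCommGroup Y] [NormedSpace ℝ Y] {F : X → Y} {y : X} {v : Y}
    (hv : v ∈ filippov F y) (L : Y →L[ℝ] ℝ) {h s : X → ℝ} {θ : ℝ} (hh : Continuous h)
    (hs : Continuous s) (hF : ∀ z, L (F z) = h z + θ * sgn (s z)) :
    ∃ σ : ℝ, |σ| ≤ 1 ∧ σ * s y = |s y| ∧ L v = h y + θ * σ := by
  -- Applied with `r = 0`, `c = ±θ` where `s y ≠ 0` (the sign is locally constant), and with `r =
  -- |θ|`, `c = 0` where `s y = 0`.
  have key : ∀ c r : ℝ, (∀ᶠ z in 𝓝 y, |θ * sgn (s z) - c| ≤ r) → |L v - h y - c| ≤ r := by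
    intro c r hr
    refine le_of_forall_pos_le_add fun ε hε => ?_
    have h1 : ∀ᶠ z in 𝓝 y, |h z - h y| < ε := by
      have := hh.tendsto y
      rw [Metric.tendsto_nhds] at this
      simpa [Real.dist_eq] using this ε hε
    have := mem_of_mem_filippov hv L (Metric.isClosed_closedBall (x := h y + c) (ε := r + ε))
      (convex_closedBall _ _) (by
        filter_upwards [h1, hr] with z h1 h2
        rw [Metric.mem_closedBall, Real.dist_eq, hF]
        calc |h z + θ * sgn (s z) - (h y + c)| = |(θ * sgn (s z) - c) + (h z - h y)| := by ring_nf
          _ ≤ |θ * sgn (s z) - c| + |h z - h y| := abs_add_le _ _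
          _ ≤ r + ε := by linarith)
    rw [Metric.mem_closedBall, Real.dist_eq] at this
    rwa [sub_sub]
  rcases lt_trichotomy (s y) 0 with hneg | hzero | hpos
  · refine ⟨-1, by simp, by rw [abs_of_neg hneg]; ring, ?_⟩
    have := key (-θ) 0 (by
      filter_upwards [hs.tendsto y (Iio_mem_nhds hneg)] with z hz
      have : ¬ 0 ≤ s z := not_le.2 hz
      simp [sgn, this])
    have := abs_nonpos_iff.1 this
    linarith
  · have h0 := key 0 |θ| (Eventually.of_forall fun z => by
      unfold sgn; split_ifs <;> simp)
    rw [sub_zero] at h0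
    by_cases hθ : θ = 0
    · refine ⟨0, by simp, by simp [hzero], ?_⟩
      rw [hθ, abs_zero] at h0
      have := abs_nonpos_iff.1 h0
      linarith
    · refine ⟨(L v - h y) / θ, ?_, by simp [hzero], ?_⟩
      · rw [abs_div]
        exact div_le_one_of_le₀ h0 (abs_nonneg _)
      · field_simp
        ring
  · refine ⟨1, by simp, by rw [abs_of_pos hpos]; ring, ?_⟩
    have := key θ 0 (by
      filter_upwards [hs.tendsto y (Ioi_mem_nhds hpos)] with z hz
      have : 0 ≤ s z := le_of_lt hz
      simp [sgn, this])
    have := abs_nonpos_iff.1 this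
    linarith

/-- Almost every value of an arbitrary function belongs to its Filippov set. -/
theorem ae_mem_filippov {X Y : Type*} [PseudoMetricSpace X] [SecondCountableTopology X]
    [MeasureSpace X] [NormedAddCommGroup Y] [NormedSpace ℝ Y] [SecondCountableTopology Y]
    (f : X → Y) : ∀ᵐ x : X, f x ∈ filippov f x := by
  -- Only countably many null sets `U ∩ f ⁻¹' W` with basic open `U`, `W` have to be discarded; this
  -- needs no measurability of `f`.
  have hnull : ∀ᵐ x : X, ∀ U ∈ TopologicalSpace.countableBasis X,
      ∀ W ∈ TopologicalSpace.countableBasis Y, volume (U ∩ f ⁻¹' W) = 0 → x ∉ U ∩ f ⁻¹' W := by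
    refine (ae_ball_iff (TopologicalSpace.countable_countableBasis X)).2 fun U _ =>
      (ae_ball_iff (TopologicalSpace.countable_countableBasis Y)).2 fun W _ => ?_
    by_cases h : volume (U ∩ f ⁻¹' W) = 0
    · filter_upwards [measure_eq_zero_iff_ae_notMem.1 h] with x hx _ using hx
    · exact Eventually.of_forall fun x h' => absurd h' h
  filter_upwards [hnull] with x hx
  simp only [filippov, mem_iInter]
  intro δ hδ M hM
  refine closure_mono (subset_convexHull ℝ _) ?_
  rw [(TopologicalSpace.isBasis_countableBasis Y).mem_closure_iff]
  intro W hW hfW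
  obtain ⟨U, hU, hxU, hUb⟩ := (TopologicalSpace.isBasis_countableBasis X).exists_subset_of_mem_open
    (Metric.mem_ball_self hδ) Metric.isOpen_ball
  -- A set that is not null still has a point after removal of `M`.
  have hpos : volume (U ∩ f ⁻¹' W) ≠ 0 := fun h0 => hx U hU W hW h0 ⟨hxU, hfW⟩
  have hne : ((U ∩ f ⁻¹' W) \ M).Nonempty := by
    rw [nonempty_iff_ne_empty]
    intro he
    exact hpos (measure_mono_null (sdiff_eq_empty.1 he) hM)
  obtain ⟨z, ⟨hzU, hzW⟩, hzM⟩ := hne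
  exact ⟨f z, hzW, z, ⟨hUb hzU, hzM⟩, rfl⟩

/-! ### Extreme eigenvalues and quadratic forms -/

section Spectral

variable {ι : Type*} [Fintype ι] [DecidableEq ι]

theorem finite_spectrum {M : Matrix ι ι ℝ} (hM : M.IsHermitian) : (spectrum ℝ M).Finite := by
  rw [hM.spectrum_real_eq_range_eigenvalues]
  exact finite_range _

theorem lamMin_mem_spectrum [Nonempty ι] {M : Matrix ι ι ℝ} (hM : M.IsHermitian) :
    lamMin M ∈ spectrum ℝ M :=
  Nonempty.csInf_mem (by rw [hM.spectrum_real_eq_range_eigenvalues]; exact range_nonempty _)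
    (finite_spectrum hM)

theorem lamMin_le_lamMax [Nonempty ι] {M : Matrix ι ι ℝ} (hM : M.IsHermitian) :
    lamMin M ≤ lamMax M :=
  le_csSup (finite_spectrum hM).bddAbove (lamMin_mem_spectrum hM)

theorem lamMin_pos [Nonempty ι] {M : Matrix ι ι ℝ} (hM : M.PosDef) : 0 < lamMin M := by
  have h := lamMin_mem_spectrum hM.isHermitian
  rw [hM.isHermitian.spectrum_real_eq_range_eigenvalues] at h
  obtain ⟨i, hi⟩ := h
  rw [← hi]
  exact hM.eigenvalues_pos i

theorem posSemidef_sub_lamMin {M : Matrix ι ι ℝ} (hM : M.IsHermitian) :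
    (M - lamMin M • (1 : Matrix ι ι ℝ)).PosSemidef := by
  have hH : (M - lamMin M • (1 : Matrix ι ι ℝ)).IsHermitian :=
    hM.sub (by simp [Matrix.IsHermitian])
  rw [hH.posSemidef_iff_eigenvalues_nonneg]
  intro i
  obtain ⟨r, hr⟩ : ∃ r, r = hH.eigenvalues i := ⟨_, rfl⟩
  have hi : r ∈ spectrum ℝ (M - lamMin M • (1 : Matrix ι ι ℝ)) := by
    rw [hH.spectrum_real_eq_range_eigenvalues, hr]
    exact mem_range_self i
  rw [← Algebra.algebraMap_eq_smul_one, ← spectrum.sub_singleton_eq] at hi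
  obtain ⟨x, hx, y, hy, hxy⟩ := hi
  have := csInf_le (finite_spectrum hM).bddBelow hx
  rw [mem_singleton_iff] at hy
  rw [Pi.zero_apply, ← hr, ← hxy, hy]
  exact sub_nonneg.2 this

local notation "𝕋" => Matrix.toEuclideanCLM (𝕜 := ℝ)

theorem Matrix.PosSemidef.inner_toEuclideanCLM_nonneg {P : Matrix ι ι ℝ} (hP : P.PosSemidef)
    (x : EuclideanSpace ℝ ι) : 0 ≤ inner ℝ x (𝕋 P x) := by
  rw [Matrix.inner_toEuclideanCLM]
  simpa using hP.dotProduct_mulVec_nonneg x.ofLp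

theorem inner_toEuclideanCLM_left (P : Matrix ι ι ℝ) (x y : EuclideanSpace ℝ ι) :
    inner ℝ (𝕋 P x) y = inner ℝ x (𝕋 Pᵀ y) := by
  rw [real_inner_comm, Matrix.inner_toEuclideanCLM, Matrix.inner_toEuclideanCLM,
    Matrix.dotProduct_mulVec, dotProduct_comm, Matrix.mulVec_transpose]

theorem mul_norm_sq_le_inner {P : Matrix ι ι ℝ} {α : ℝ}
    (h : (P - α • (1 : Matrix ι ι ℝ)).PosSemidef) (x : EuclideanSpace ℝ ι) :
    α * ‖x‖ ^ 2 ≤ inner ℝ x (𝕋 P x) := by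
  have := h.inner_toEuclideanCLM_nonneg x
  rw [map_sub, map_smul, map_one, sub_apply, inner_sub_right] at this
  simp only [smul_apply, one_apply_eq_self, inner_smul_right,
    real_inner_self_eq_norm_sq] at this
  linarith

/-- This is `α P ≤ Pᵀ P`, obtained from Cauchy–Schwarz: with `r = ⟪x, P x⟫`, `α r² ≤ α ‖x‖² ‖P x‖² ≤
r ‖P x‖²`, and `r` cancels. -/
theorem mul_inner_le_norm_sq {P : Matrix ι ι ℝ} {α : ℝ} (hα : 0 < α)
    (h : (P - α • (1 : Matrix ι ι ℝ)).PosSemidef) (x : EuclideanSpace ℝ ι) :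
    α * inner ℝ x (𝕋 P x) ≤ ‖𝕋 P x‖ ^ 2 := by
  have h1 := mul_norm_sq_le_inner h x
  have h2 : inner ℝ x (𝕋 P x) ≤ ‖x‖ * ‖𝕋 P x‖ := real_inner_le_norm _ _
  set r := inner ℝ x (𝕋 P x)
  have h0 : 0 ≤ r := le_trans (by positivity) h1
  rcases h0.eq_or_lt with h0 | h0
  · rw [← h0]; simp
  have h3 : r ^ 2 ≤ (‖x‖ * ‖𝕋 P x‖) ^ 2 := pow_le_pow_left₀ h0.le h2 2
  have h4 : α * r ^ 2 ≤ r * ‖𝕋 P x‖ ^ 2 := by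
    calc α * r ^ 2 ≤ α * (‖x‖ * ‖𝕋 P x‖) ^ 2 := by gcongr
      _ = α * ‖x‖ ^ 2 * ‖𝕋 P x‖ ^ 2 := by ring
      _ ≤ _ := by gcongr
  refine le_of_mul_le_mul_left ?_ h0
  linarith

/-- Finite-time convergence to the origin from a quadratic Lyapunov function `⟪e, P e⟫` with
`⟪P e, e'⟫ ≤ -c ‖P e‖`. -/
theorem eventually_eq_zero_of_quadratic_lyapunov {P : Matrix ι ι ℝ} (hP : P.PosDef)
    {e : ℝ → EuclideanSpace ℝ ι} (he : LocallyAC e) {T₀ c : ℝ} (hT₀ : 0 ≤ T₀) (hc : 0 < c)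
    (hd : ∀ᵐ t : ℝ, T₀ < t → ∃ v, HasDerivAt e v t ∧
      inner ℝ (𝕋 P (e t)) v ≤ -c * ‖𝕋 P (e t)‖) :
    ∀ᶠ t in atTop, e t = 0 := by
  rcases isEmpty_or_nonempty ι with hι | hι
  · exact Eventually.of_forall fun t => Subsingleton.elim _ _
  have hα := lamMin_pos hP
  have hPα := posSemidef_sub_lamMin hP.isHermitian
  have hsym : Pᵀ = P := by simpa using hP.isHermitian.eq
  set α := lamMin P
  have hW := eventually_eq_zero_of_deriv_le_neg_sqrt (W := fun t => inner ℝ (e t) (𝕋 P (e t)))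
    (a := T₀) (c := 2 * c * √α) (by positivity)
    (fun t => hP.posSemidef.inner_toEuclideanCLM_nonneg (e t))
    (fun b hb => by
      refine ((he b (hT₀.trans_lt hb)).mono ?_).comp_contDiff
        (φ := fun x => inner ℝ x (𝕋 P x)) (contDiff_id.inner ℝ (𝕋 P).contDiff)
      rw [uIcc_of_le hb.le, uIcc_of_le (hT₀.trans hb.le)]
      exact Icc_subset_Icc_left hT₀)
    (by
      filter_upwards [hd] with t ht hT
      obtain ⟨v, hv, hle⟩ := ht hT
      refine ⟨_, hv.inner ℝ ((𝕋 P).hasFDerivAt.comp_hasDerivAt t hv), ?_⟩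
      -- Together with `W' = 2 ⟪P e, e'⟫ ≤ -2c ‖P e‖` this explains the constant `2 * c * √α`.
      have h1 : √α * √(inner ℝ (e t) (𝕋 P (e t))) ≤ ‖𝕋 P (e t)‖ := by
        rw [← Real.sqrt_mul hα.le]
        exact Real.sqrt_le_iff.2 ⟨norm_nonneg _, mul_inner_le_norm_sq hα hPα _⟩
      have h2 : inner ℝ (e t) (𝕋 P v) = inner ℝ (𝕋 P (e t)) v := by
        rw [inner_toEuclideanCLM_left, hsym]
      rw [h2, real_inner_comm _ v]
      nlinarith)
  filter_upwards [hW] with t ht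
  have := mul_norm_sq_le_inner hPα (e t)
  rw [ht] at this
  have h0 : ‖e t‖ ^ 2 ≤ 0 := by
    by_contra! h
    nlinarith
  simpa using h0


/-! ### Kronecker products and the gain condition. -/

variable {κ : Type*} [Fintype κ] [DecidableEq κ]

theorem posSemidef_kronecker_one_sub {M : Matrix ι ι ℝ} {α : ℝ}
    (h : (M - α • (1 : Matrix ι ι ℝ)).PosSemidef) :
    (M ⊗ₖ (1 : Matrix κ κ ℝ) - α • (1 : Matrix (ι × κ) (ι × κ) ℝ)).PosSemidef := by
  have := h.kronecker (Matrix.PosSemidef.one (n := κ) (R := ℝ))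
  rwa [show (M - α • (1 : Matrix ι ι ℝ)) ⊗ₖ (1 : Matrix κ κ ℝ) =
    M ⊗ₖ (1 : Matrix κ κ ℝ) - (α • (1 : Matrix ι ι ℝ)) ⊗ₖ (1 : Matrix κ κ ℝ) by
      ext; simp [sub_mul], Matrix.smul_kronecker, Matrix.one_kronecker_one] at this

theorem posSemidef_one_kronecker_sub {M : Matrix κ κ ℝ} {α : ℝ}
    (h : (M - α • (1 : Matrix κ κ ℝ)).PosSemidef) :
    ((1 : Matrix ι ι ℝ) ⊗ₖ M - α • (1 : Matrix (ι × κ) (ι × κ) ℝ)).PosSemidef := by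
  have := (Matrix.PosSemidef.one (n := ι) (R := ℝ)).kronecker h
  rwa [show (1 : Matrix ι ι ℝ) ⊗ₖ (M - α • (1 : Matrix κ κ ℝ)) =
    (1 : Matrix ι ι ℝ) ⊗ₖ M - (1 : Matrix ι ι ℝ) ⊗ₖ (α • (1 : Matrix κ κ ℝ)) by
      ext; simp [mul_sub], Matrix.kronecker_smul, Matrix.one_kronecker_one] at this

/-- With a gain `ω` above the threshold, the linear innovation dominates the linear and the
Lipschitz terms of the error dynamics. -/
theorem inner_add_inner_le_gain {M : Matrix ι ι ℝ} {G A : Matrix κ κ ℝ} [Nonempty ι]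
    (hM : M.PosDef) (hG : G.PosDef)
    (hGA : (-(Gᵀ * A + Aᵀ * G - (2 : ℝ) • (Gᵀ * G))).PosDef) {lf ω : ℝ} (hlf : 0 ≤ lf)
    (hω : 1 / lamMin M * (1 + lf * specNorm (M ⊗ₖ G) / (lamMin M * lamMin (Gᵀ * G))) ≤ ω)
    {e F : EuclideanSpace ℝ (ι × κ)} (hF : ‖F‖ ≤ lf * ‖e‖) :
    inner ℝ (𝕋 (M ⊗ₖ G) e) F + inner ℝ (𝕋 (M ⊗ₖ G) e) (𝕋 ((1 : Matrix ι ι ℝ) ⊗ₖ A) e) ≤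
      ω * ‖𝕋 (M ⊗ₖ G) e‖ ^ 2 := by
  rcases isEmpty_or_nonempty κ with hκ | hκ
  · have he : e = 0 := Subsingleton.elim _ _
    simp [he]
  have hGs : Gᵀ = G := by simpa using hG.isHermitian.eq
  have hMs : Mᵀ = M := by simpa using hM.isHermitian.eq
  have hGG : (Gᵀ * G).PosDef := by
    have := Matrix.PosDef.conjTranspose_mul_self G
      (Matrix.mulVec_injective_iff_isUnit.2 hG.isUnit)
    simpa using this
  have hlam := lamMin_pos hM
  have hmu := lamMin_pos hGG
  have hMl := posSemidef_kronecker_one_sub (κ := κ) (posSemidef_sub_lamMin hM.isHermitian)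
  have hGm := posSemidef_one_kronecker_sub (ι := ι) (posSemidef_sub_lamMin hGG.isHermitian)
  set lam := lamMin M
  set mu := lamMin (Gᵀ * G)
  set Y := 𝕋 ((1 : Matrix ι ι ℝ) ⊗ₖ G) e with hY
  have hmul : ∀ (P Q : Matrix (ι × κ) (ι × κ) ℝ) (x : EuclideanSpace ℝ (ι × κ)),
      𝕋 P (𝕋 Q x) = 𝕋 (P * Q) x := fun P Q x => by rw [map_mul]; rfl
  have hX : 𝕋 (M ⊗ₖ G) e = 𝕋 (M ⊗ₖ (1 : Matrix κ κ ℝ)) Y := by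
    rw [hY, hmul, ← Matrix.mul_kronecker_mul, mul_one, one_mul]
  have h1 : lam * inner ℝ Y (𝕋 (M ⊗ₖ (1 : Matrix κ κ ℝ)) Y) ≤ ‖𝕋 (M ⊗ₖ G) e‖ ^ 2 := by
    rw [hX]; exact mul_inner_le_norm_sq hlam hMl Y
  have h2 : lam ^ 2 * ‖Y‖ ^ 2 ≤ ‖𝕋 (M ⊗ₖ G) e‖ ^ 2 := by
    have := mul_norm_sq_le_inner hMl Y
    nlinarith
  have h3 : mu * ‖e‖ ^ 2 ≤ ‖Y‖ ^ 2 := by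
    have := mul_norm_sq_le_inner hGm e
    rw [← real_inner_self_eq_norm_sq Y, hY, inner_toEuclideanCLM_left, hmul,
      ← Matrix.kroneckerMap_transpose, ← Matrix.mul_kronecker_mul]
    simpa using this
  have h4 : inner ℝ (𝕋 (M ⊗ₖ G) e) (𝕋 ((1 : Matrix ι ι ℝ) ⊗ₖ A) e) ≤
      inner ℝ Y (𝕋 (M ⊗ₖ (1 : Matrix κ κ ℝ)) Y) := by
    -- The matrix inequality on `G` and `A`, tensored with `M`. Since `ha` and `hb` express the same
    -- scalar, its quadratic form is twice the difference of the two sides of `h4`.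
    have hps := (hM.posSemidef.kronecker hGA.posSemidef).inner_toEuclideanCLM_nonneg e
    have ha : inner ℝ (𝕋 (M ⊗ₖ G) e) (𝕋 ((1 : Matrix ι ι ℝ) ⊗ₖ A) e) =
        inner ℝ e (𝕋 (M ⊗ₖ (Gᵀ * A)) e) := by
      rw [inner_toEuclideanCLM_left, hmul, ← Matrix.kroneckerMap_transpose,
        ← Matrix.mul_kronecker_mul, hMs, mul_one]
    have hb : inner ℝ (𝕋 (M ⊗ₖ G) e) (𝕋 ((1 : Matrix ι ι ℝ) ⊗ₖ A) e) =
        inner ℝ e (𝕋 (M ⊗ₖ (Aᵀ * G)) e) := by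
      rw [real_inner_comm, inner_toEuclideanCLM_left, hmul, ← Matrix.kroneckerMap_transpose,
        ← Matrix.mul_kronecker_mul, Matrix.transpose_one, one_mul]
    have hc : inner ℝ Y (𝕋 (M ⊗ₖ (1 : Matrix κ κ ℝ)) Y) =
        inner ℝ e (𝕋 (M ⊗ₖ (Gᵀ * G)) e) := by
      rw [hY, inner_toEuclideanCLM_left, hmul, hmul, ← Matrix.kroneckerMap_transpose,
        ← Matrix.mul_kronecker_mul, ← Matrix.mul_kronecker_mul]
      simp
    have hk : M ⊗ₖ (-(Gᵀ * A + Aᵀ * G - (2 : ℝ) • (Gᵀ * G))) =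
        (2 : ℝ) • (M ⊗ₖ (Gᵀ * G)) - M ⊗ₖ (Gᵀ * A) - M ⊗ₖ (Aᵀ * G) := by
      ext ⟨i, a⟩ ⟨j, b⟩
      simp
      ring
    rw [hk] at hps
    simp only [map_sub, map_smul, sub_apply, smul_apply, inner_sub_right, inner_smul_right] at hps
    linarith
  have h5 : ‖𝕋 (M ⊗ₖ G) e‖ ≤ specNorm (M ⊗ₖ G) * ‖e‖ := ContinuousLinearMap.le_opNorm _ _
  have h6 : inner ℝ (𝕋 (M ⊗ₖ G) e) F ≤ ‖𝕋 (M ⊗ₖ G) e‖ * ‖F‖ := real_inner_le_norm _ _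
  have hs : 0 ≤ specNorm (M ⊗ₖ G) := norm_nonneg _
  set s := specNorm (M ⊗ₖ G)
  set x := ‖𝕋 (M ⊗ₖ G) e‖
  have h7 : inner ℝ (𝕋 (M ⊗ₖ G) e) F ≤ lf * s * ‖e‖ ^ 2 := by
    calc _ ≤ x * ‖F‖ := h6
      _ ≤ (s * ‖e‖) * (lf * ‖e‖) := by gcongr
      _ = _ := by ring
  -- One passes from `e` to `Y = (1 ⊗ G) e`, losing `mu`, and from `Y` to `(M ⊗ 1) Y`, losing `lam ^
  -- 2`.
  have h8 : ‖e‖ ^ 2 ≤ x ^ 2 / (lam ^ 2 * mu) := by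
    rw [le_div_iff₀ (by positivity)]
    nlinarith
  have h9 : inner ℝ Y (𝕋 (M ⊗ₖ (1 : Matrix κ κ ℝ)) Y) ≤ x ^ 2 / lam := by
    rw [le_div_iff₀ hlam]
    linarith
  calc _ ≤ lf * s * (x ^ 2 / (lam ^ 2 * mu)) + x ^ 2 / lam := by
        have : lf * s * ‖e‖ ^ 2 ≤ lf * s * (x ^ 2 / (lam ^ 2 * mu)) := by gcongr
        linarith
    _ = 1 / lam * (1 + lf * s / (lam * mu)) * x ^ 2 := by field_simp; ring
    _ ≤ ω * x ^ 2 := by gcongr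

end Spectral

/-- A selection of the set-valued sign recovers at least the Euclidean norm. -/
theorem norm_le_inner_sign {ι : Type*} [Fintype ι] {x s : EuclideanSpace ℝ ι} (h : ∀ r, s r * x r = |x r|) :
    ‖x‖ ≤ inner ℝ x s := by
  have hs : inner ℝ x s = ∑ r, |x r| := by
    simp only [PiLp.inner_apply, RCLike.inner_apply, conj_trivial]
    exact Finset.sum_congr rfl fun r _ => h r
  rw [hs, EuclideanSpace.norm_eq]
  refine Real.sqrt_le_iff.2 ⟨Finset.sum_nonneg fun _ _ => abs_nonneg _, ?_⟩
  exact Finset.sum_sq_le_sq_sum_of_nonneg fun r _ => abs_nonneg (x r)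

/-! ### The graph matrices and the innovations -/

section Graph

/-- A vertex other than `l` has a neighbour that is one step closer to `l`. -/
theorem SimpleGraph.Connected.exists_adj_dist_add_one_eq {V : Type*} {G : SimpleGraph V} (hG : G.Connected)
    {i l : V} (h : i ≠ l) : ∃ j, G.Adj i j ∧ G.dist j l + 1 = G.dist i l := by
  obtain ⟨p, hp⟩ := hG.exists_walk_length_eq_dist i l
  cases p with
  | nil => exact absurd rfl h
  | @cons _ j _ hij p =>
    refine ⟨j, hij, ?_⟩
    have h1 := SimpleGraph.dist_le p
    have h2 : G.dist i l ≤ G.dist i j + G.dist j l := hG.dist_triangle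
    rw [SimpleGraph.dist_eq_one_iff_adj.2 hij] at h2
    rw [SimpleGraph.Walk.length_cons] at hp
    omega

variable {V : Type*} [Fintype V]

theorem mem_nbr {G : SimpleGraph V} {i j : V} : j ∈ nbr G i ↔ G.Adj i j := by simp [nbr]

theorem mem_khop {G : SimpleGraph V} {k : ℕ} {i l : V} :
    l ∈ khop G k i ↔ 2 ≤ G.dist i l ∧ G.dist i l ≤ k := by simp [khop]

theorem mem_khop_comm {G : SimpleGraph V} {k : ℕ} {i l : V} :
    l ∈ khop G k i ↔ i ∈ khop G k l := by rw [mem_khop, mem_khop, G.dist_comm]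

variable [DecidableEq V]

open Classical in
theorem khopMatrix_mulVec (G : SimpleGraph V) (k : ℕ) (l : V) (v : khop G k l → ℝ)
    (i : khop G k l) :
    (khopMatrix G k l *ᵥ v) i =
      (∑ j : khop G k l, if G.Adj i j then v i - v j else 0) +
        ((nbr G i ∩ nbr G l).card : ℝ) * v i := by
  rw [khopMatrix, Matrix.add_mulVec, Pi.add_apply, Matrix.mulVec_diagonal,
    SimpleGraph.lapMatrix_mulVec_apply]
  congr 1
  rw [← Finset.sum_filter, Finset.sum_sub_distrib, Finset.sum_const, nsmul_eq_mul]
  have : (SimpleGraph.comap (Subtype.val : khop G k l → V) G).neighborFinset i =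
      Finset.univ.filter (fun j : khop G k l => G.Adj i j) := by
    ext j; simp
  rw [← SimpleGraph.card_neighborFinset_eq_degree, this]

/-- If the quadratic form vanishes at `x`, both of its nonnegative parts do: `x` is constant along
edges inside the `k`-hop set, and zero at vertices sharing a neighbour with `l`. Shortest paths to
`l` carry the zero outwards, by induction on the distance. -/
theorem posDef_khopMatrix {G : SimpleGraph V} (hG : G.Connected) (k : ℕ) (l : V) :
    (khopMatrix G k l).PosDef := by
  classical
  set H := SimpleGraph.comap (Subtype.val : khop G k l → V) G with hH
  set D : khop G k l → ℝ := fun i => ((nbr G i ∩ nbr G l).card : ℝ) with hD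
  have hL : (H.lapMatrix ℝ).PosSemidef := SimpleGraph.posSemidef_lapMatrix ℝ H
  have hDp : (Matrix.diagonal D).PosSemidef :=
    Matrix.PosSemidef.diagonal fun i => by simp [hD]
  have hM : khopMatrix G k l = H.lapMatrix ℝ + Matrix.diagonal D := by
    unfold khopMatrix
    congr!
  rw [hM]
  refine Matrix.PosDef.of_dotProduct_mulVec_pos (hL.add hDp).isHermitian fun {x} hx => ?_
  have h1 := hL.dotProduct_mulVec_nonneg x
  have h2 := hDp.dotProduct_mulVec_nonneg x
  rw [Matrix.add_mulVec, dotProduct_add]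
  refine lt_of_le_of_ne (add_nonneg h1 h2) fun h0 => hx ?_
  have h1' : x ⬝ᵥ H.lapMatrix ℝ *ᵥ x = 0 := by simp only [star_trivial] at *; linarith
  have h2' : x ⬝ᵥ Matrix.diagonal D *ᵥ x = 0 := by simp only [star_trivial] at *; linarith
  rw [← Matrix.toLinearMap₂'_apply',
    SimpleGraph.lapMatrix_toLinearMap₂'_apply'_eq_zero_iff_forall_adj] at h1'
  simp only [dotProduct, Matrix.mulVec_diagonal] at h2'
  rw [Finset.sum_eq_zero_iff_of_nonneg (fun i _ => by
    have : x i * (D i * x i) = D i * x i ^ 2 := by ring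
    rw [this]; simp only [hD]; positivity)] at h2'
  have key : ∀ n : ℕ, ∀ i : khop G k l, G.dist (i : V) l = n → x i = 0 := by
    intro n
    induction n with
    | zero => intro i hi; have := mem_khop.1 i.2; rw [G.dist_comm] at this; omega
    | succ n ih =>
      intro i hi
      have hi2 := mem_khop.1 i.2
      rw [G.dist_comm] at hi2
      obtain ⟨j, hij, hj⟩ := hG.exists_adj_dist_add_one_eq (i := (i : V)) (l := l) (by
        intro h; rw [h, G.dist_self] at hi2; omega)
      -- Here `i` is at distance `n + 1` from `l`. At distance `2` the next vertex `j` is a common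
      -- neighbour; farther away `j` is at distance between `2` and `k`, so it is again a `k`-hop
      -- neighbour.
      by_cases h2 : n = 1
      · have hjl : G.Adj j l := SimpleGraph.dist_eq_one_iff_adj.1 (by omega)
        have hpos : 0 < D i := by
          simp only [hD, Nat.cast_pos, Finset.card_pos]
          exact ⟨j, Finset.mem_inter.2 ⟨mem_nbr.2 hij, mem_nbr.2 hjl.symm⟩⟩
        have := h2' i (Finset.mem_univ _)
        rcases mul_eq_zero.1 this with h | h
        · exact h
        · exact (mul_eq_zero.1 h).resolve_left hpos.ne'
      · have hjk : j ∈ khop G k l := mem_khop.2 (by rw [G.dist_comm]; omega)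
        rw [h1' i ⟨j, hjk⟩ (by simpa [hH] using hij)]
        exact ih ⟨j, hjk⟩ (by simp only; omega)
  exact funext fun i => key _ i rfl

end Graph

/-! ### Regrouping the estimates by estimated agent. -/

namespace MultiAgentSystem

variable {V : Type*} [Fintype V] [DecidableEq V] {N : ℕ} (S : MultiAgentSystem V N)

/-- The index of the estimate made by `i` of agent `l`. -/
noncomputable def est {l : V} (i : khop S.graph S.k l) : EstIndex S.graph S.k :=
  ⟨i, ⟨l, mem_khop_comm.1 i.2⟩⟩

/-- The entry `a` of the estimate `p`. -/
noncomputable def entry (p : EstIndex S.graph S.k) (a : Fin N) : S.Est →L[ℝ] ℝ :=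
  (EuclideanSpace.proj a : AgentVec N →L[ℝ] ℝ) ∘L PiLp.proj 2 (fun _ => AgentVec N) p

/-- The entries of a stacked vector that refer to agent `l`. -/
noncomputable def column (l : V) : S.Est →L[ℝ] EuclideanSpace ℝ (khop S.graph S.k l × Fin N) :=
  (EuclideanSpace.equiv (khop S.graph S.k l × Fin N) ℝ).symm.toContinuousLinearMap ∘L
    ContinuousLinearMap.pi fun r => S.entry (S.est r.1) r.2

theorem entry_apply (p : EstIndex S.graph S.k) (a : Fin N) (w : S.Est) :
    S.entry p a w = w p a := rfl

@[simp]
theorem column_apply (l : V) (w : S.Est) (r : khop S.graph S.k l × Fin N) :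
    S.column l w r = w (S.est r.1) r.2 := rfl

theorem eq_zero_of_column_eq_zero {w : S.Est} (h : ∀ l, S.column l w = 0) : w = 0 := by
  ext ⟨i, l, hl⟩ a
  have := congrArg (fun v => v (⟨i, mem_khop_comm.1 hl⟩, a)) (h l)
  exact this

theorem innovation_apply (w : TeamVec V N) (wh : S.Est) (p : EstIndex S.graph S.k) (a : Fin N) :
    S.innovation w wh p a = ∑ j ∈ nbr S.graph p.1,
      ((if h : (p.2 : V) ∈ khop S.graph S.k j then wh ⟨j, ⟨p.2, h⟩⟩ a - wh p a else 0) +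
      (if (p.2 : V) ∈ nbr S.graph j then w p.2 a - wh p a else 0)) := by
  simp only [innovation, WithLp.ofLp_sum, Finset.sum_apply]
  refine Finset.sum_congr rfl fun j _ => ?_
  rw [PiLp.add_apply]
  congr 1 <;> split_ifs <;> rfl

/-- A neighbour `j` of `i` that estimates `l` contributes the difference of errors `e_i - e_j`, a
Laplacian term; a neighbour of both `i` and `l` contributes `e_i`, a diagonal term. -/
theorem column_innovation (l : V) (w : TeamVec V N) (wh : S.Est) :
    S.column l (S.innovation w wh) =
      Matrix.toEuclideanCLM (𝕜 := ℝ)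
        (khopMatrix S.graph S.k l ⊗ₖ (1 : Matrix (Fin N) (Fin N) ℝ))
        (S.column l (S.truth w - wh)) := by
  classical
  ext ⟨i, a⟩
  have hR : (Matrix.toEuclideanCLM (𝕜 := ℝ)
        (khopMatrix S.graph S.k l ⊗ₖ (1 : Matrix (Fin N) (Fin N) ℝ))
        (S.column l (S.truth w - wh))) (i, a) =
      (khopMatrix S.graph S.k l *ᵥ fun j => (S.truth w - wh) (S.est j) a) i := by
    rw [Matrix.ofLp_toEuclideanCLM]
    simp only [Matrix.mulVec, dotProduct, Fintype.sum_prod_type, Matrix.kroneckerMap_apply,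
      column_apply, Matrix.one_apply]
    simp
  rw [hR, khopMatrix_mulVec]
  have hval : ∀ j : khop S.graph S.k l, (S.truth w - wh) (S.est j) a = w l a - wh (S.est j) a :=
    fun j => rfl
  simp only [hval]
  have hL : S.column l (S.innovation w wh) (i, a) = ∑ j ∈ nbr S.graph i,
      ((if h : l ∈ khop S.graph S.k j then wh ⟨j, ⟨l, h⟩⟩ a - wh (S.est i) a else 0) +
      (if l ∈ nbr S.graph j then w l a - wh (S.est i) a else 0)) :=
    S.innovation_apply w wh (S.est i) a
  rw [hL, Finset.sum_add_distrib]
  congr 1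
  · rw [← Finset.sum_filter_of_ne (p := fun j => l ∈ khop S.graph S.k j)
      (fun j _ h => by by_contra h'; simp [h'] at h)]
    rw [← Finset.sum_filter]
    symm
    refine Finset.sum_bij (fun j _ => (j : V)) ?_ ?_ ?_ ?_
    · intro j hj
      simp only [Finset.mem_filter, Finset.mem_univ, true_and] at hj
      exact Finset.mem_filter.2 ⟨mem_nbr.2 hj, mem_khop_comm.1 j.2⟩
    · intro j _ j' _ h
      exact Subtype.ext h
    · intro j hj
      rw [Finset.mem_filter, mem_nbr] at hj
      exact ⟨⟨j, mem_khop_comm.1 hj.2⟩, by simpa using hj.1, rfl⟩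
    · intro j _
      rw [dif_pos (mem_khop_comm.1 j.2)]
      simp only [est]
      ring
  · rw [← Finset.sum_filter, Finset.sum_const, nsmul_eq_mul]
    congr 3
    ext j
    simp only [Finset.mem_filter, Finset.mem_inter, mem_nbr, S.graph.adj_comm j l]

end MultiAgentSystem

theorem map_eq_of_mem_filippov {X Y Z : Type*} [PseudoMetricSpace X] [MeasureSpace X]
    [NormedAddCommGroup Y] [NormedSpace ℝ Y] [NormedAddCommGroup Z] [NormedSpace ℝ Z]
    {F : X → Y} {y : X} {v : Y} (hv : v ∈ filippov F y) (L : Y →L[ℝ] Z)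
    (hF : ContinuousAt (fun z => L (F z)) y) : L v = L (F y) := by
  refine eq_of_forall_dist_le fun ε hε => ?_
  exact mem_of_mem_filippov hv L Metric.isClosed_closedBall (convex_closedBall (L (F y)) ε)
    (hF.tendsto (Metric.closedBall_mem_nhds _ hε))

namespace MultiAgentSystem

variable {V : Type*} [Fintype V] [DecidableEq V] {N : ℕ} (S : MultiAgentSystem V N)

/-! ### Stacked vectors -/

/-- The vector all of whose blocks are `b`. -/
noncomputable def spread (l : V) :
    AgentVec N →L[ℝ] EuclideanSpace ℝ (khop S.graph S.k l × Fin N) :=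
  (EuclideanSpace.equiv (khop S.graph S.k l × Fin N) ℝ).symm.toContinuousLinearMap ∘L
    ContinuousLinearMap.pi fun r => (EuclideanSpace.proj r.2 : AgentVec N →L[ℝ] ℝ)

theorem spread_apply (l : V) (b : AgentVec N) (r : khop S.graph S.k l × Fin N) :
    S.spread l b r = b r.2 := rfl

theorem norm_spread (l : V) (b : AgentVec N) :
    ‖S.spread l b‖ = √((khop S.graph S.k l).card : ℝ) * ‖b‖ := by
  rw [← sq_eq_sq₀ (norm_nonneg _) (by positivity), EuclideanSpace.real_norm_sq_eq, mul_pow,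
    Real.sq_sqrt (Nat.cast_nonneg _), EuclideanSpace.real_norm_sq_eq, Fintype.sum_prod_type]
  simp [spread_apply]

theorem norm_sq_column (l : V) (w : S.Est) :
    ‖S.column l w‖ ^ 2 = ∑ i : khop S.graph S.k l, ‖w (S.est i)‖ ^ 2 := by
  simp only [EuclideanSpace.real_norm_sq_eq, Fintype.sum_prod_type, column_apply]

theorem norm_column_le {l : V} {w w' : S.Est} {c : ℝ} (hc : 0 ≤ c) (h : ∀ p, ‖w' p‖ ≤ c * ‖w p‖) :
    ‖S.column l w'‖ ≤ c * ‖S.column l w‖ := by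
  rw [← sq_le_sq₀ (norm_nonneg _) (by positivity), mul_pow, norm_sq_column, norm_sq_column,
    Finset.mul_sum]
  refine Finset.sum_le_sum fun i _ => ?_
  rw [← mul_pow]
  exact pow_le_pow_left₀ (norm_nonneg _) (h _) 2

theorem one_kronecker_column (l : V) (B : Matrix (Fin N) (Fin N) ℝ) (w : S.Est) :
    Matrix.toEuclideanCLM (𝕜 := ℝ) ((1 : Matrix (khop S.graph S.k l) (khop S.graph S.k l) ℝ) ⊗ₖ B)
        (S.column l w) =
      S.column l (WithLp.toLp 2 fun p => Matrix.toEuclideanCLM (𝕜 := ℝ) B (w p)) := by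
  ext ⟨i, a⟩
  rw [Matrix.ofLp_toEuclideanCLM]
  simp only [Matrix.mulVec, dotProduct, Fintype.sum_prod_type, Matrix.kroneckerMap_apply,
    column_apply, Matrix.one_apply, Matrix.ofLp_toEuclideanCLM]
  simp

/-- Since `M ⊗ G = (1 ⊗ G)(M ⊗ 1)`, the signal `G ξ` used by the state observer is `P e` for the
Lyapunov matrix `P = M ⊗ G`. -/
theorem kronecker_column_sub (l : V) (G : Matrix (Fin N) (Fin N) ℝ) (w : TeamVec V N)
    (wh : S.Est) :
    Matrix.toEuclideanCLM (𝕜 := ℝ) (khopMatrix S.graph S.k l ⊗ₖ G)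
        (S.column l (S.truth w - wh)) =
      S.column l (WithLp.toLp 2 fun p =>
        Matrix.toEuclideanCLM (𝕜 := ℝ) G (S.innovation w wh p)) := by
  rw [← one_kronecker_column, column_innovation, ← mul_apply_eq_comp, ← map_mul,
    ← Matrix.mul_kronecker_mul, mul_one, one_mul]

/-! ### The right-hand side of the closed loop -/

theorem continuous_feedback (hq : ∀ i, Continuous (fun p : _ × _ => S.q i p.1 p.2)) :
    Continuous (fun p : TeamVec V N × S.Est => S.feedback p.1 p.2) := by
  refine (PiLp.continuous_toLp 2 _).comp (continuous_pi fun i => ?_)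
  exact (hq i).comp (by fun_prop :
    Continuous fun p : TeamVec V N × S.Est =>
      ((fun j : (insert i (nbr S.graph i) : Finset V) => p.1 j), fun l => p.2 ⟨i, l⟩))

theorem continuous_plant (hf : Continuous S.f) :
    Continuous (fun p : TeamVec V N × TeamVec V N => S.plant p.1 p.2) := by
  refine (PiLp.continuous_toLp 2 _).comp (continuous_pi fun i => ?_)
  fun_prop

theorem continuous_innovation :
    Continuous (fun p : TeamVec V N × S.Est => S.innovation p.1 p.2) := by
  refine (PiLp.continuous_toLp 2 _).comp (continuous_pi fun r => ?_)
  refine continuous_finsetSum _ fun j _ => Continuous.add ?_ ?_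
  · split_ifs <;> fun_prop
  · split_ifs <;> fun_prop

variable {S} {g : ObserverGains V N} {y v : S.LoopState}

/-- The signs occur only in the observers; the plant component is continuous, so its Filippov set is
a single point. -/
theorem fst_of_mem_filippov (hf : Continuous S.f)
    (hq : ∀ i, Continuous (fun p : _ × _ => S.q i p.1 p.2))
    (hv : v ∈ filippov (S.closedLoop g) y) : v.1 = S.plant y.1 (S.feedback y.1 y.2.1) := by
  refine map_eq_of_mem_filippov hv (ContinuousLinearMap.fst ℝ (TeamVec V N) (S.Est × S.Est)) ?_
  exact ((S.continuous_plant hf).comp (continuous_fst.prodMk ((S.continuous_feedback hq).comp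
    (continuous_fst.prodMk (continuous_fst.comp continuous_snd))))).continuousAt

theorem inputObserver_of_mem_filippov
    (hq : ∀ i, Continuous (fun p : _ × _ => S.q i p.1 p.2))
    (hv : v ∈ filippov (S.closedLoop g) y) (p : EstIndex S.graph S.k) (a : Fin N) :
    ∃ σ : ℝ, σ * S.innovation (S.feedback y.1 y.2.1) y.2.2 p a =
        |S.innovation (S.feedback y.1 y.2.1) y.2.2 p a| ∧ v.2.2 p a = g.π p.2 * σ := by
  have hs : Continuous fun z : S.LoopState =>
      S.innovation (S.feedback z.1 z.2.1) z.2.2 p a := by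
    have h1 := S.continuous_innovation.comp (((S.continuous_feedback hq).comp
      (continuous_fst.prodMk (continuous_fst.comp continuous_snd))).prodMk
      ((continuous_snd.comp continuous_snd) : Continuous fun z : S.LoopState => z.2.2))
    exact (S.entry p a).continuous.comp h1
  obtain ⟨σ, -, h1, h2⟩ := exists_sign_of_mem_filippov hv
    (S.entry p a ∘L ContinuousLinearMap.snd ℝ S.Est S.Est ∘L
      ContinuousLinearMap.snd ℝ (TeamVec V N) (S.Est × S.Est)) (h := fun _ => 0)
    (θ := g.π p.2) continuous_const hs (fun z => (zero_add _).symm)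
  exact ⟨σ, h1, h2.trans (zero_add _)⟩

theorem stateObserver_of_mem_filippov (hf : Continuous S.f)
    (hv : v ∈ filippov (S.closedLoop g) y) (p : EstIndex S.graph S.k) (a : Fin N) :
    ∃ σ : ℝ, σ * Matrix.toEuclideanCLM (𝕜 := ℝ) g.G (S.innovation y.1 y.2.1 p) a =
        |Matrix.toEuclideanCLM (𝕜 := ℝ) g.G (S.innovation y.1 y.2.1 p) a| ∧
      v.2.1 p a = (S.f (y.2.1 p) + Matrix.toEuclideanCLM (𝕜 := ℝ) S.A (y.2.1 p) +
        g.ω p.2 • Matrix.toEuclideanCLM (𝕜 := ℝ) g.G (S.innovation y.1 y.2.1 p) +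
          y.2.2 p) a + g.θ p.2 * σ := by
  have hi : Continuous fun z : S.LoopState =>
      Matrix.toEuclideanCLM (𝕜 := ℝ) g.G (S.innovation z.1 z.2.1 p) := by
    have h1 := S.continuous_innovation.comp ((continuous_fst.prodMk
      (continuous_fst.comp continuous_snd)) : Continuous fun z : S.LoopState => (z.1, z.2.1))
    exact (Matrix.toEuclideanCLM (𝕜 := ℝ) g.G).continuous.comp
      ((PiLp.proj 2 (fun _ => AgentVec N) p : S.Est →L[ℝ] AgentVec N).continuous.comp h1)
  have ha : Continuous fun w : AgentVec N => w a :=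
    (EuclideanSpace.proj a : AgentVec N →L[ℝ] ℝ).continuous
  obtain ⟨σ, -, h1, h2⟩ := exists_sign_of_mem_filippov hv
    (S.entry p a ∘L ContinuousLinearMap.fst ℝ S.Est S.Est ∘L
      ContinuousLinearMap.snd ℝ (TeamVec V N) (S.Est × S.Est))
    (h := fun z => (S.f (z.2.1 p) + Matrix.toEuclideanCLM (𝕜 := ℝ) S.A (z.2.1 p) +
        g.ω p.2 • Matrix.toEuclideanCLM (𝕜 := ℝ) g.G (S.innovation z.1 z.2.1 p) +
          z.2.2 p) a)
    (θ := g.θ p.2) (ha.comp (by fun_prop)) (ha.comp hi) (fun z => by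
      simp only [closedLoop, stateObserver, Function.comp_apply, ContinuousLinearMap.comp_apply, entry_apply,
        ContinuousLinearMap.coe_snd', ContinuousLinearMap.coe_fst', PiLp.add_apply,
        PiLp.smul_apply, smul_eq_mul]
      ring)
  exact ⟨σ, h1, h2⟩

end MultiAgentSystem

/-! ### Finite-time convergence of the observers. -/

namespace MultiAgentSystem

variable {V : Type*} [Fintype V] [DecidableEq V] {N : ℕ} {S : MultiAgentSystem V N}
  {g : ObserverGains V N}

/-- The time derivative of the feedback is bounded almost everywhere by the bound on its Filippov
set. -/
theorem ae_norm_deriv_le {u : ℝ → AgentVec N} {b : ℝ}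
    (h : ∀ t : ℝ, 0 < t → ∀ w ∈ filippov (deriv u) t, ‖w‖ ≤ b) :
    ∀ᵐ t : ℝ, 0 < t → ‖deriv u t‖ ≤ b := by
  filter_upwards [ae_mem_filippov (deriv u)] with t ht h0 using h t h0 _ ht

/-- A norm is at most `b` at almost every positive time, and `(0, ∞)` is not null. -/
theorem bound_nonneg {u : ℝ → AgentVec N} {b : ℝ}
    (h : ∀ t : ℝ, 0 < t → ∀ w ∈ filippov (deriv u) t, ‖w‖ ≤ b) : 0 ≤ b := by
  by_contra! hb
  have h1 : ∀ᵐ t : ℝ, t ∉ Ioi (0 : ℝ) := by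
    filter_upwards [ae_norm_deriv_le h] with t ht h0
    exact absurd ((norm_nonneg _).trans (ht h0)) (not_le.2 hb)
  have h2 := measure_eq_zero_iff_ae_notMem.2 h1
  simp at h2

/-- Finite-time convergence of the input observers of agent `l`. -/
theorem eventually_column_input_error_eq_zero (hconn : S.graph.Connected)
    (hq : ∀ i, Continuous (fun p : _ × _ => S.q i p.1 p.2)) {d : V → ℝ} (l : V)
    (hπ : (khop S.graph S.k l).Nonempty →
      lamMax (khopMatrix S.graph S.k l) / lamMin (khopMatrix S.graph S.k l) *
        √((khop S.graph S.k l).card : ℝ) * d l < g.π l)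
    {z : ℝ → S.LoopState} (hz : IsFilippovSolution (S.closedLoop g) z)
    (hqAC : LocallyAC (fun t => S.feedback (z t).1 (z t).2.1 l))
    (hqK : ∀ t : ℝ, 0 < t →
      ∀ w ∈ filippov (deriv (fun s => S.feedback (z s).1 (z s).2.1 l)) t, ‖w‖ ≤ d l) :
    ∀ᶠ t in atTop, S.column l (S.truth (S.feedback (z t).1 (z t).2.1) - (z t).2.2) = 0 := by
  rcases (khop S.graph S.k l).eq_empty_or_nonempty with hK | hK
  · have : IsEmpty (khop S.graph S.k l) := by
      rw [hK]; infer_instance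
    exact Eventually.of_forall fun t => Subsingleton.elim _ _
  have : Nonempty (khop S.graph S.k l) := hK.to_subtype
  have hM := posDef_khopMatrix hconn S.k l
  have hlam := lamMin_pos hM
  have hd := bound_nonneg hqK
  -- The weighting by `M` needs only this bound; the eigenvalue ratio in the hypothesis is at least
  -- `1`.
  have hπ' : √((khop S.graph S.k l).card : ℝ) * d l < g.π l := by
    refine lt_of_le_of_lt ?_ (hπ hK)
    have h1 : 1 ≤ lamMax (khopMatrix S.graph S.k l) / lamMin (khopMatrix S.graph S.k l) :=
      (one_le_div hlam).2 (lamMin_le_lamMax hM.isHermitian)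
    have h2 : 0 ≤ √((khop S.graph S.k l).card : ℝ) * d l := by positivity
    rw [mul_assoc]
    exact le_mul_of_one_le_left h2 h1
  have hπ0 : 0 ≤ g.π l := le_trans (by positivity) hπ'.le
  -- As `q` is merely continuous, absolute continuity of `u_l` is not inherited from the state and
  -- comes from `hqAC`.
  have hAC : LocallyAC fun t =>
      S.column l (S.truth (S.feedback (z t).1 (z t).2.1) - (z t).2.2) := by
    intro T hT
    have h1 := (hqAC.comp_clm (S.spread l)) T hT
    have h2 := (hz.1.comp_clm (S.column l ∘L ContinuousLinearMap.snd ℝ S.Est S.Est ∘L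
      ContinuousLinearMap.snd ℝ (TeamVec V N) (S.Est × S.Est))) T hT
    have h3 := h1.fun_sub h2
    exact h3
  refine eventually_eq_zero_of_quadratic_lyapunov
    (hM.kronecker (Matrix.PosDef.one (n := Fin N) (R := ℝ))) hAC le_rfl
    (sub_pos.2 hπ') ?_
  filter_upwards [hz.2, hqAC.ae_differentiableAt, ae_norm_deriv_le hqK] with t h1 h2 h3 h0
  obtain ⟨v, hv, hzv⟩ := h1 h0
  have hu := (h2 h0).hasDerivAt
  set w := deriv (fun s => S.feedback (z s).1 (z s).2.1 l) t
  refine ⟨S.spread l w - S.column l v.2.2, ?_, ?_⟩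
  · exact ((S.spread l).hasFDerivAt.comp_hasDerivAt t hu).sub
      ((S.column l ∘L ContinuousLinearMap.snd ℝ S.Est S.Est ∘L
        ContinuousLinearMap.snd ℝ (TeamVec V N) (S.Est × S.Est)).hasFDerivAt.comp_hasDerivAt t hzv)
  · rw [← column_innovation]
    choose σ hσ hσv using inputObserver_of_mem_filippov hq hv
    set X := S.column l (S.innovation (S.feedback (z t).1 (z t).2.1) (z t).2.2) with hX
    set s : EuclideanSpace ℝ (khop S.graph S.k l × Fin N) :=
      WithLp.toLp 2 fun r => σ (S.est r.1) r.2 with hs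
    have hvs : S.column l v.2.2 = g.π l • s := by
      ext r
      exact hσv (S.est r.1) r.2
    have hXs : ‖X‖ ≤ inner ℝ X s := norm_le_inner_sign fun r => hσ (S.est r.1) r.2
    have hXw : inner ℝ X (S.spread l w) ≤ ‖X‖ * (√((khop S.graph S.k l).card : ℝ) * d l) := by
      refine (real_inner_le_norm _ _).trans ?_
      rw [norm_spread]
      gcongr
      exact h3 h0
    rw [inner_sub_right, hvs, inner_smul_right]
    nlinarith [mul_le_mul_of_nonneg_left hXs hπ0]

/-- Finite-time convergence of the state observers of agent `l`, once the input observers have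
converged. -/
theorem eventually_column_state_error_eq_zero (hconn : S.graph.Connected) {lf : ℝ≥0}
    (hf : LipschitzWith lf S.f) (hq : ∀ i, Continuous (fun p : _ × _ => S.q i p.1 p.2))
    (hG : g.G.PosDef)
    (hGA : (-(g.Gᵀ * S.A + S.Aᵀ * g.G - (2 : ℝ) • (g.Gᵀ * g.G))).PosDef) (l : V)
    (hω : (khop S.graph S.k l).Nonempty →
      1 / lamMin (khopMatrix S.graph S.k l) *
        (1 + lf * specNorm (khopMatrix S.graph S.k l ⊗ₖ g.G) /
          (lamMin (khopMatrix S.graph S.k l) * lamMin (g.Gᵀ * g.G))) ≤ g.ω l)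
    (hθ : (khop S.graph S.k l).Nonempty → 0 < g.θ l)
    {z : ℝ → S.LoopState} (hz : IsFilippovSolution (S.closedLoop g) z)
    (hinput : ∀ᶠ t in atTop,
      S.column l (S.truth (S.feedback (z t).1 (z t).2.1) - (z t).2.2) = 0) :
    ∀ᶠ t in atTop, S.column l (S.truth (z t).1 - (z t).2.1) = 0 := by
  rcases (khop S.graph S.k l).eq_empty_or_nonempty with hK | hK
  · have : IsEmpty (khop S.graph S.k l) := by
      rw [hK]; infer_instance
    exact Eventually.of_forall fun t => Subsingleton.elim _ _
  have : Nonempty (khop S.graph S.k l) := hK.to_subtype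
  have hM := posDef_khopMatrix hconn S.k l
  set L : S.LoopState →L[ℝ] EuclideanSpace ℝ (khop S.graph S.k l × Fin N) :=
    S.spread l ∘L (PiLp.proj 2 (fun _ => AgentVec N) l : TeamVec V N →L[ℝ] AgentVec N) ∘L
        ContinuousLinearMap.fst ℝ (TeamVec V N) (S.Est × S.Est) -
      S.column l ∘L ContinuousLinearMap.fst ℝ S.Est S.Est ∘L
        ContinuousLinearMap.snd ℝ (TeamVec V N) (S.Est × S.Est)
  have hL : ∀ y : S.LoopState, S.column l (S.truth y.1 - y.2.1) = L y := fun _ => rfl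
  obtain ⟨T, hT⟩ := eventually_atTop.1 hinput
  simp only [hL]
  refine eventually_eq_zero_of_quadratic_lyapunov (hM.kronecker hG) (hz.1.comp_clm L)
    (le_max_right T 0) (hθ hK) ?_
  filter_upwards [hz.2] with t h1 ht
  obtain ⟨v, hv, hzv⟩ := h1 ((le_max_right _ _).trans_lt ht)
  have hin := hT t ((le_max_left _ _).trans ht.le)
  refine ⟨L v, L.hasFDerivAt.comp_hasDerivAt t hzv, ?_⟩
  choose σ hσ hσv using stateObserver_of_mem_filippov hf.continuous hv
  have hv1 := fst_of_mem_filippov hf.continuous hq hv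
  set e : S.Est := S.truth (z t).1 - (z t).2.1 with he
  rw [← hL (z t)]
  set s : EuclideanSpace ℝ (khop S.graph S.k l × Fin N) :=
    WithLp.toLp 2 fun r => σ (S.est r.1) r.2 with hs
  set D : S.Est := WithLp.toLp 2 fun p => S.f ((z t).1 p.2) - S.f ((z t).2.1 p) with hD
  set X := Matrix.toEuclideanCLM (𝕜 := ℝ) (khopMatrix S.graph S.k l ⊗ₖ g.G) (S.column l e) with hX
  have hX' : X = S.column l (WithLp.toLp 2 fun p =>
      Matrix.toEuclideanCLM (𝕜 := ℝ) g.G (S.innovation (z t).1 (z t).2.1 p)) :=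
    S.kronecker_column_sub l g.G _ _
  have hXs : ‖X‖ ≤ inner ℝ X s := by
    rw [hX']
    exact norm_le_inner_sign fun r => hσ (S.est r.1) r.2
  have hDle : ‖S.column l D‖ ≤ lf * ‖S.column l e‖ := by
    refine S.norm_column_le lf.coe_nonneg fun p => ?_
    have := hf.dist_le_mul ((z t).1 p.2) ((z t).2.1 p)
    rw [dist_eq_norm, dist_eq_norm] at this
    exact this
  have hgain := inner_add_inner_le_gain hM hG hGA lf.coe_nonneg (hω hK) hDle
  have hLv : L v = S.column l D +
      Matrix.toEuclideanCLM (𝕜 := ℝ)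
        ((1 : Matrix (khop S.graph S.k l) (khop S.graph S.k l) ℝ) ⊗ₖ S.A) (S.column l e) -
      g.ω l • X - g.θ l • s := by
    rw [hX', one_kronecker_column]
    ext ⟨i, a⟩
    have h1 : L v (i, a) = v.1 l a - v.2.1 (S.est i) a := rfl
    have h2 := congrArg (fun x : EuclideanSpace ℝ (khop S.graph S.k l × Fin N) => x (i, a)) hin
    have h3 : S.feedback (z t).1 (z t).2.1 l a - (z t).2.2 (S.est i) a = 0 := h2
    have h4 : e (S.est i) = (z t).1 l - (z t).2.1 (S.est i) := rfl
    rw [h1, hσv, hv1]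
    simp only [plant, PiLp.add_apply, PiLp.sub_apply, PiLp.smul_apply, column_apply, smul_eq_mul,
      hs, hD, h4, map_sub]
    simp only [est]
    simp only [est] at h3
    linarith
  rw [hLv, inner_sub_right, inner_sub_right, inner_add_right, inner_smul_right, inner_smul_right,
    real_inner_self_eq_norm_sq]
  have := mul_le_mul_of_nonneg_left hXs (hθ hK).le
  linarith

/-- Once the estimates are exact, the team is a solution of the unforced system. -/
theorem isForcedSolution_zero_of_error_eq_zero (hf : Continuous S.f)
    (hq : ∀ i, Continuous (fun p : _ × _ => S.q i p.1 p.2))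
    {z : ℝ → S.LoopState} (hz : IsFilippovSolution (S.closedLoop g) z) {T : ℝ} (hT : 0 ≤ T)
    (he : ∀ t, T < t → S.truth (z t).1 - (z t).2.1 = 0) :
    IsForcedSolution S.Φ (fun _ => 0) (fun t => (z (t + T)).1) := by
  refine ⟨(hz.1.shift hT).comp_clm (ContinuousLinearMap.fst ℝ (TeamVec V N) (S.Est × S.Est)), ?_⟩
  have h := (measurePreserving_add_right (volume : Measure ℝ) T).quasiMeasurePreserving.ae hz.2
  filter_upwards [h] with t ht h0
  obtain ⟨v, hv, hzv⟩ := ht (by linarith)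
  refine ⟨v.1, ?_, ?_⟩
  · rw [mem_singleton_iff, fst_of_mem_filippov hf hq hv, Φ, sub_zero,
      sub_eq_zero.1 (he (t + T) (by linarith))]
  · exact (ContinuousLinearMap.fst ℝ (TeamVec V N) (S.Est × S.Est)).hasFDerivAt.comp_hasDerivAt t
      (hzv.comp_add_const t T)

end MultiAgentSystem

/-! ### Set-ISS and the closed loop. -/

/-- Unforced solutions of a set-ISS system approach the set. -/
theorem SetISS.tendsto_infDist {X W : Type*} [NormedAddCommGroup X] [NormedSpace ℝ X]
    [NormedAddCommGroup W] {Φ : X → W → X} {𝒜 : Set X} (h : SetISS Φ 𝒜) {y : ℝ → X}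
    (hy : IsForcedSolution Φ (fun _ => 0) y) :
    Tendsto (fun t => Metric.infDist (y t) 𝒜) atTop (𝓝 0) := by
  obtain ⟨β, γ, hβ, hγ, h⟩ := h
  refine squeeze_zero' (Eventually.of_forall fun _ => Metric.infDist_nonneg) ?_
    (hβ.2 (Metric.infDist (y 0) 𝒜) Metric.infDist_nonneg).2
  filter_upwards [eventually_ge_atTop 0] with t ht
  have := h (fun _ => 0) y aestronglyMeasurable_const
    ⟨0, by rintro _ ⟨_, _, rfl⟩; simp⟩ hy t ht
  rwa [Set.Nonempty.image_const (nonempty_Icc.2 ht), csSup_singleton, norm_zero, hγ.2.2,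
    add_zero] at this

theorem mainTheorem3 {V : Type*} [Fintype V] [DecidableEq V] {N : ℕ}
    (S : MultiAgentSystem V N) (g : ObserverGains V N) (lf : ℝ≥0) (d : V → ℝ)
    (𝒜 : Set (TeamVec V N))
    (hconn : S.graph.Connected)
    (hf : LipschitzWith lf S.f)
    (hq : ∀ i, Continuous (fun p : _ × _ => S.q i p.1 p.2))
    (hG : g.G.PosDef)
    (hGA : (-(g.Gᵀ * S.A + S.Aᵀ * g.G - (2 : ℝ) • (g.Gᵀ * g.G))).PosDef)
    (hω : ∀ i, (khop S.graph S.k i).Nonempty →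
      1 / lamMin (khopMatrix S.graph S.k i) *
        (1 + lf * specNorm (khopMatrix S.graph S.k i ⊗ₖ g.G) /
          (lamMin (khopMatrix S.graph S.k i) * lamMin (g.Gᵀ * g.G))) ≤ g.ω i)
    (hθ : ∀ i, (khop S.graph S.k i).Nonempty → 0 < g.θ i)
    (hπ : ∀ i, (khop S.graph S.k i).Nonempty →
      lamMax (khopMatrix S.graph S.k i) / lamMin (khopMatrix S.graph S.k i) *
        √((khop S.graph S.k i).card : ℝ) * d i < g.π i)
    (h𝒜 : 𝒜.Nonempty)
    (hISS : SetISS S.Φ 𝒜)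
    (z : ℝ → S.LoopState)
    (hz : IsFilippovSolution (S.closedLoop g) z)
    (hqAC : ∀ i, LocallyAC (fun t => S.feedback (z t).1 (z t).2.1 i))
    (hqK : ∀ i, ∀ t : ℝ, 0 < t →
      ∀ w ∈ filippov (deriv (fun s => S.feedback (z s).1 (z s).2.1 i)) t, ‖w‖ ≤ d i) :
    (∃ T : ℝ, 0 < T ∧ ∀ t, T < t →
      S.truth (z t).1 - (z t).2.1 = 0 ∧
      S.truth (S.feedback (z t).1 (z t).2.1) - (z t).2.2 = 0) ∧
    Tendsto (fun t => Metric.infDist (z t).1 𝒜) atTop (𝓝 0) ∧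
    (S.NominalReaches 𝒜 →
      ∃ xs ∈ 𝒜, S.Φ xs 0 = 0 ∧ Tendsto (fun t => (z t).1) atTop (𝓝 xs)) := by
  have hinput : ∀ l, ∀ᶠ t in atTop,
      S.column l (S.truth (S.feedback (z t).1 (z t).2.1) - (z t).2.2) = 0 := fun l =>
    MultiAgentSystem.eventually_column_input_error_eq_zero hconn hq l (hπ l) hz (hqAC l) (hqK l)
  have hstate : ∀ l, ∀ᶠ t in atTop, S.column l (S.truth (z t).1 - (z t).2.1) = 0 := fun l =>
    MultiAgentSystem.eventually_column_state_error_eq_zero hconn hf hq hG hGA l (hω l) (hθ l) hz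
      (hinput l)
  obtain ⟨T₀, hT₀⟩ := eventually_atTop.1 ((eventually_all.2 hstate).and (eventually_all.2 hinput))
  set T := max T₀ 1
  have hT : 0 < T := lt_of_lt_of_le one_pos (le_max_right _ _)
  have herr : ∀ t, T < t → S.truth (z t).1 - (z t).2.1 = 0 ∧
      S.truth (S.feedback (z t).1 (z t).2.1) - (z t).2.2 = 0 := fun t ht =>
    have h := hT₀ t ((le_max_left _ _).trans ht.le)
    ⟨S.eq_zero_of_column_eq_zero h.1, S.eq_zero_of_column_eq_zero h.2⟩
  have hy := MultiAgentSystem.isForcedSolution_zero_of_error_eq_zero hf.continuous hq hz hT.le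
    fun t ht => (herr t ht).1
  have hshift : Tendsto (fun t : ℝ => t - T) atTop atTop :=
    tendsto_atTop_add_const_right _ _ tendsto_id
  refine ⟨⟨T, hT, herr⟩, ?_, fun hnom => ?_⟩
  · simpa [Function.comp_def] using (hISS.tendsto_infDist hy).comp hshift
  · obtain ⟨xs, hxs, heq, hlim⟩ := hnom _ hy
    exact ⟨xs, hxs, heq, by simpa [Function.comp_def] using hlim.comp hshift⟩
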